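/- Let $A$ be a scalar type spectral operator, with domain $D(A)$, in a complex Banach space $X$, let $0\le\beta<\infty$, and let $I\subseteq[0,\infty)$ be an interval containing more than one point. (That is, there is a strongly countably additive spectral measure $E_A$ on the Borel sets of $\mathbb C$, with values in the bounded projections on $X$, $E_A(\mathbb C)=\mathrm{Id}$ and $E_A(\delta\cap\sigma)=E_A(\delta)E_A(\sigma)$, whose support is the spectrum $\sigma(A)$, such that $A=\int_{\sigma(A)}\lambda\,dE_A(\lambda)$, i.e. $D(A)$ is the set of $f\in X$ for which $\lim_{n\to\infty}\int_{\{\lambda\in\sigma(A):|\lambda|\le n\}}\lambda\,dE_A(\lambda)f$ exists, and $Af$ is this limit. Such an $A$ is closed and densely defined.) Let $y:[0,\infty)\to X$ be a weak solution of $y'(t)=Ay(t)$, $t\ge0$: $y$ is continuous in norm and, for every $g^*$ in the domain of the adjoint $A^*$ and every $t\ge0$, $\frac{d}{dt}\langle y(t),g^*\rangle=\langle y(t),A^*g^*\rangle$ (a one-sided derivative at $t=0$). Let $\mathscr E^{\{\beta\}}(I,X)$ (resp. $\mathscr E^{(\beta)}(I,X)$) be the set of functions $g:I\to X$ that are infinitely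 differentiable in norm on $I$ (one-sidedly at endpoints of $I$) and such that for every $[a,b]\subseteq I$ there are $\alpha>0$ and $c>0$ (resp. for every $[a,b]\subseteq I$ and every $\alpha>0$ there is $c>0$) with $$\max_{a\le t\le b}\|g^{(n)}(t)\|\le c\,\alpha^n(n!)^\beta,\qquad n=0,1,2,\dots$$ Let $\mathscr E^{\{\beta\}}(A)$ (resp. $\mathscr E^{(\beta)}(A)$) be the set of $x\in\bigcap_{n\ge0}D(A^n)$ such that there are $\alpha>0$ and $c>0$ (resp. for every $\alpha>0$ there is $c>0$) with $\|A^nx\|\le c\,\alpha^n(n!)^\beta$ for $n=0,1,2,\dots$ Then the restriction of $y$ to $I$ belongs to $\mathscr E^{\{\beta\}}(I,X)$ if and only if $y(t)\in\mathscr E^{\{\beta\}}(A)$ for each $t\in I$; likewise, the restriction of $y$ to $I$ belongs to $\mathscr E^{(\beta)}(I,X)$ if and only if $y(t)\in\mathscr E^{(\beta)}(A)$ for each $t\in I$. In either case, for all $n\in\mathbb N$ and $t\in I$, $y(t)\in D(A^n)$ and $$y^{(n)}(t)=A^ny(t),$$ where $y^{(n)}$ is the $n$th derivative of $y$ on $I$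 (one-sided at endpoints of $I$). -/

import Mathlib

open Set Filter Topology MeasureTheory
open scoped ContDiff

noncomputable section

namespace Gevrey

variable {X : Type*} [NormedAddCommGroup X] [NormedSpace ℂ X]

/-! ### Unbounded operators: composition, powers, spectrum -/

/-- The product `B A` of two (unbounded) operators, on its maximal domain
`{x ∈ D(A) | A x ∈ D(B)}`. -/
def opMul (B A : X →ₗ.[ℂ] X) : X →ₗ.[ℂ] X where
  domain := (B.domain.comap A.toFun).map A.domain.subtype
  toFun :=
    { toFun := fun x => B ⟨A ⟨x, by obtain ⟨z, -, hz⟩ := x.2; rw [← hz]; exact z.2⟩, by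
        obtain ⟨x, z, hz, rfl⟩ := x; exact hz⟩
      map_add' := fun x y => by
        rw [← LinearPMap.map_add]; congr 1; ext1; simp only [Submodule.coe_add]
        rw [← LinearPMap.map_add]; rfl
      map_smul' := fun c x => by
        rw [RingHom.id_apply, ← LinearPMap.map_smul]; congr 1; ext1
        simp only [Submodule.coe_smul]
        rw [← LinearPMap.map_smul]; rfl }

/-- The powers of an operator: `A ^ 0 = I` (everywhere defined) and `A ^ (n + 1) = A (A ^ n)` with
domain `{x ∈ D(A ^ n) | A ^ n x ∈ D(A)}`. -/
def opPow (A : X →ₗ.[ℂ] X) : ℕ → (X →ₗ.[ℂ] X)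
  | 0 => (LinearMap.id : X →ₗ[ℂ] X).toPMap ⊤
  | n + 1 => opMul A (opPow A n)

/-- `z` is in the resolvent set of `A`: the operator `z I - A : D(A) → X` has a bounded,
everywhere defined two-sided inverse `R`. -/
def IsResolventPoint (A : X →ₗ.[ℂ] X) (z : ℂ) : Prop :=
  ∃ R : X →L[ℂ] X,
    (∀ x : X, ∃ h : R x ∈ A.domain, z • R x - A ⟨R x, h⟩ = x) ∧
    ∀ x : A.domain, R (z • (x : X) - A x) = x

/-- The spectrum `σ(A)` of an unbounded operator. -/
def opSpectrum (A : X →ₗ.[ℂ] X) : Set ℂ := {z | ¬ IsResolventPoint A z}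

/-! ### Spectral measures and scalar type spectral operators -/

variable (X) in
/-- A strongly countably additive, projection-valued measure on the Borel sets of the complex
plane. Values on non-Borel sets are irrelevant. (Each `E δ` is a projection, by `inter` with
`s = t`; `E ∅ = 0`, by `hasSum` with empty sets; uniform boundedness is automatic.) -/
structure SpectralMeasure where
  /-- the projection assigned to a Borel set -/
  proj : Set ℂ → X →L[ℂ] X
  univ : proj univ = ContinuousLinearMap.id ℂ X
  inter : ∀ s t : Set ℂ, MeasurableSet s → MeasurableSet t →
    proj (s ∩ t) = (proj s).comp (proj t)
  hasSum : ∀ δ : ℕ → Set ℂ, (∀ n, MeasurableSet (δ n)) → Pairwise (Function.onFun Disjoint δ) →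
    ∀ x : X, HasSum (fun n => proj (δ n) x) (proj (⋃ n, δ n) x)

namespace SpectralMeasure

/-- The (closed) support of a spectral measure. -/
def support (E : SpectralMeasure X) : Set ℂ :=
  {z | ∀ U : Set ℂ, IsOpen U → z ∈ U → E.proj U ≠ 0}

/-- `∫ φ dE = ∑ c E(φ = c)` for a simple Borel function `φ`. -/
def simpleIntegral (E : SpectralMeasure X) (φ : SimpleFunc ℂ ℂ) : X →L[ℂ] X :=
  ∑ c ∈ φ.range, c • E.proj (φ ⁻¹' {c})

/-- `T = ∫ F dE` for a bounded Borel function `F`: `T` is the limit in operator norm of the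
integrals of simple functions converging uniformly to `F`. -/
def HasBoundedIntegral (E : SpectralMeasure X) (F : ℂ → ℂ) (T : X →L[ℂ] X) : Prop :=
  ∃ φ : ℕ → SimpleFunc ℂ ℂ, TendstoUniformly (fun n z => φ n z) F atTop ∧
    Tendsto (fun n => E.simpleIntegral (φ n)) atTop (𝓝 T)

/-- `x` is in the domain of the (possibly unbounded) operator `∫ F dE`, and `(∫ F dE) x = y`:
the truncations `Fₙ = F · χ_{|F| ≤ n}` satisfy `(∫ Fₙ dE) x → y`. -/
def HasIntegralAt (E : SpectralMeasure X) (F : ℂ → ℂ) (x y : X) : Prop :=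
  ∃ T : ℕ → X →L[ℂ] X,
    (∀ n : ℕ, E.HasBoundedIntegral ({z | ‖F z‖ ≤ n}.indicator F) (T n)) ∧
    Tendsto (fun n => T n x) atTop (𝓝 y)

end SpectralMeasure

/-- `A` is a scalar type spectral operator with spectral measure (resolution of the identity) `E`:
the support of `E` is the spectrum of `A`, and `A = ∫ z dE(z)`, domains included.
(Such an operator is automatically closed and densely defined.) -/
structure IsSpectralMeasureOf (E : SpectralMeasure X) (A : X →ₗ.[ℂ] X) : Prop where
  support_eq : E.support = opSpectrum A
  mem_graph_iff : ∀ x y : X, (x, y) ∈ A.graph ↔ E.HasIntegralAt (fun z => z) x y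

/-! ### Weak solutions -/

/-- `g ∈ D(A*)` and `A* g = h` for the (Banach space) adjoint `A*` of a densely defined
operator `A`. -/
def HasAdjointAt (A : X →ₗ.[ℂ] X) (g h : StrongDual ℂ X) : Prop :=
  ∀ x : A.domain, g (A x) = h x

/-- `y : [0, ∞) → X` is a weak solution of `y' = A y`: it is continuous, and
`d/dt ⟨y(t), g⟩ = ⟨y(t), A* g⟩` on `[0, ∞)` for every `g ∈ D(A*)` (one-sided derivative at `0`).
Only the values of `y` on `[0, ∞)` matter. -/
def IsWeakSolution (A : X →ₗ.[ℂ] X) (y : ℝ → X) : Prop :=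
  ContinuousOn y (Ici 0) ∧
    ∀ g h : StrongDual ℂ X, HasAdjointAt A g h →
      ∀ t ∈ Ici (0 : ℝ), HasDerivWithinAt (fun s => g (y s)) (h (y t)) (Ici 0) t

/-! ### Gevrey classes of functions -/

/-- The Gevrey class of order `β` of Roumieu type on the interval `I` (for functions on `ℝ` of
which only the restriction to `I` matters; derivatives are one-sided at endpoints of `I`). -/
def gevreyRoumieuOn (β : ℝ) (I : Set ℝ) : Set (ℝ → X) :=
  {g | ContDiffOn ℝ ∞ g I ∧ ∀ a b : ℝ, Icc a b ⊆ I → ∃ α > (0 : ℝ), ∃ c > (0 : ℝ),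
    ∀ n : ℕ, ∀ t ∈ Icc a b, ‖iteratedDerivWithin n g I t‖ ≤ c * α ^ n * (n.factorial : ℝ) ^ β}

/-- The Gevrey class of order `β` of Beurling type on the interval `I`. -/
def gevreyBeurlingOn (β : ℝ) (I : Set ℝ) : Set (ℝ → X) :=
  {g | ContDiffOn ℝ ∞ g I ∧ ∀ a b : ℝ, Icc a b ⊆ I → ∀ α > (0 : ℝ), ∃ c > (0 : ℝ),
    ∀ n : ℕ, ∀ t ∈ Icc a b, ‖iteratedDerivWithin n g I t‖ ≤ c * α ^ n * (n.factorial : ℝ) ^ β}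

/-! ### Gevrey classes of vectors -/

/-- The Gevrey class of order `β` of Roumieu type of vectors of `A`, a subset of
`C^∞(A) = ⋂ₙ D(A ^ n)`. -/
def gevreyRoumieuVec (β : ℝ) (A : X →ₗ.[ℂ] X) : Set X :=
  {x | ∃ hx : ∀ n : ℕ, x ∈ (opPow A n).domain, ∃ α > (0 : ℝ), ∃ c > (0 : ℝ),
    ∀ n : ℕ, ‖opPow A n ⟨x, hx n⟩‖ ≤ c * α ^ n * (n.factorial : ℝ) ^ β}

/-- The Gevrey class of order `β` of Beurling type of vectors of `A`. -/
def gevreyBeurlingVec (β : ℝ) (A : X →ₗ.[ℂ] X) : Set X :=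
  {x | ∃ hx : ∀ n : ℕ, x ∈ (opPow A n).domain, ∀ α > (0 : ℝ), ∃ c > (0 : ℝ),
    ∀ n : ℕ, ‖opPow A n ⟨x, hx n⟩‖ ≤ c * α ^ n * (n.factorial : ℝ) ^ β}

end Gevrey

end

/-!
Cutting `A` down to the spectral subspaces of the discs `‖z‖ ≤ k` turns `y' = A y` into linear
equations `u' = T u` with `T = ∫ F dE` bounded. The spectral projection of `{Re F ≤ 0}` makes the
flow of `T` bounded forward in time, and that of the complement makes it bounded backward in time,
with a constant depending on `E` only. Hence `‖u t‖ ≤ C (‖u a‖ + ‖u b‖)` for `t ∈ [a, b]`, and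
letting `k → ∞` the same holds for `y` and for all `Aⁿ y`. This estimate makes `Aⁿ y` locally
Lipschitz as soon as `Aⁿ⁺¹ y` is defined, so that `y` is smooth with `y⁽ⁿ⁾ = Aⁿ y`, and it reduces
Gevrey bounds on `[a, b]` to Gevrey bounds at the two endpoints.
-/

namespace Gevrey

section Analysis

theorem sum_abs_le_of_forall_abs_sum_le {ι : Type*} {s : Finset ι} {a : ι → ℝ} {K : ℝ}
    (h : ∀ t ⊆ s, |∑ i ∈ t, a i| ≤ K) : ∑ i ∈ s, |a i| ≤ 2 * K := by
  have hpos : ∑ i ∈ s with 0 ≤ a i, |a i| ≤ K := by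
    rw [Finset.sum_congr rfl fun i hi => abs_of_nonneg (Finset.mem_filter.1 hi).2]
    exact (le_abs_self _).trans (h _ (Finset.filter_subset _ _))
  have hneg : ∑ i ∈ s with ¬ 0 ≤ a i, |a i| ≤ K := by
    rw [Finset.sum_congr rfl fun i hi => abs_of_neg (not_le.1 (Finset.mem_filter.1 hi).2),
      Finset.sum_neg_distrib]
    exact (neg_le_abs _).trans (h _ (Finset.filter_subset _ _))
  rw [← Finset.sum_filter_add_sum_filter_not s fun i => 0 ≤ a i]
  linarith

theorem norm_sum_real_smul_le {V ι : Type*} [NormedAddCommGroup V] [NormedSpace ℝ V]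
    {s : Finset ι} {x : ι → V} {K B : ℝ} (hx : ∀ t ⊆ s, ‖∑ i ∈ t, x i‖ ≤ K) (hB : 0 ≤ B)
    {c : ι → ℝ} (hc : ∀ i ∈ s, |c i| ≤ B) : ‖∑ i ∈ s, c i • x i‖ ≤ 2 * K * B := by
  obtain ⟨l, hl, hlx⟩ := exists_dual_vector'' ℝ (∑ i ∈ s, c i • x i)
  have hsum : ∑ i ∈ s, |l (x i)| ≤ 2 * K := sum_abs_le_of_forall_abs_sum_le fun t ht => by
    rw [← map_sum]
    exact (l.le_of_opNorm_le hl _).trans (by simpa using hx t ht)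
  calc ‖∑ i ∈ s, c i • x i‖ = ∑ i ∈ s, c i * l (x i) := by simpa using hlx.symm
    _ ≤ ∑ i ∈ s, B * |l (x i)| := Finset.sum_le_sum fun i hi =>
        (le_abs_self _).trans <| by rw [abs_mul]; gcongr; exact hc i hi
    _ ≤ 2 * K * B := by
        rw [← Finset.mul_sum, mul_comm]
        gcongr

theorem norm_sum_complex_smul_le {V ι : Type*} [NormedAddCommGroup V] [NormedSpace ℂ V]
    {s : Finset ι} {x : ι → V} {K B : ℝ} (hx : ∀ t ⊆ s, ‖∑ i ∈ t, x i‖ ≤ K) (hB : 0 ≤ B)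
    {c : ι → ℂ} (hc : ∀ i ∈ s, ‖c i‖ ≤ B) : ‖∑ i ∈ s, c i • x i‖ ≤ 4 * K * B := by
  have hre : ‖∑ i ∈ s, (c i).re • x i‖ ≤ 2 * K * B := norm_sum_real_smul_le hx hB fun i hi =>
    (Complex.abs_re_le_norm _).trans (hc i hi)
  have him : ‖∑ i ∈ s, (c i).im • x i‖ ≤ 2 * K * B := norm_sum_real_smul_le hx hB fun i hi =>
    (Complex.abs_im_le_norm _).trans (hc i hi)
  have hsplit : ∑ i ∈ s, c i • x i =
      ∑ i ∈ s, (c i).re • x i + Complex.I • ∑ i ∈ s, (c i).im • x i := by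
    rw [Finset.smul_sum, ← Finset.sum_add_distrib]
    refine Finset.sum_congr rfl fun i _ => ?_
    rw [← Complex.coe_smul, ← Complex.coe_smul, smul_smul, ← add_smul, mul_comm, Complex.re_add_im]
  calc ‖∑ i ∈ s, c i • x i‖
      ≤ ‖∑ i ∈ s, (c i).re • x i‖ + ‖∑ i ∈ s, (c i).im • x i‖ := by
        rw [hsplit]
        exact (norm_add_le _ _).trans_eq (by rw [norm_smul, Complex.norm_I, one_mul])
    _ ≤ 4 * K * B := by linarith

theorem tendstoUniformly_mul_of_norm_le {ι α R : Type*} [SeminormedRing R] {l : Filter ι}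
    {F G : ι → α → R} {f g : α → R} (hF : TendstoUniformly F f l) (hG : TendstoUniformly G g l)
    {Bf Bg : ℝ} (hf : ∀ z, ‖f z‖ ≤ Bf) (hg : ∀ z, ‖g z‖ ≤ Bg) :
    TendstoUniformly (fun n => F n * G n) (f * g) l := by
  simp only [tendstoUniformly_iff_tendsto, tendsto_uniformity_iff_dist_tendsto_zero] at hF hG ⊢
  have hlim := ((hF.mul hG).add (hF.mul_const Bg)).add (hG.const_mul Bf)
  rw [zero_mul, zero_mul, mul_zero, add_zero, add_zero] at hlim
  refine squeeze_zero (fun _ => dist_nonneg) (fun ⟨n, z⟩ => ?_) hlim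
  simp only [dist_eq_norm, Pi.mul_apply]
  calc ‖f z * g z - F n z * G n z‖
      = ‖-((f z - F n z) * (g z - G n z)) + (f z - F n z) * g z + f z * (g z - G n z)‖ := by
        congr 1; noncomm_ring
    _ ≤ ‖f z - F n z‖ * ‖g z - G n z‖ + ‖f z - F n z‖ * ‖g z‖ + ‖f z‖ * ‖g z - G n z‖ := by
        refine norm_add₃_le.trans ?_
        rw [norm_neg]
        gcongr <;> exact norm_mul_le _ _
    _ ≤ _ := by gcongr <;> solve_by_elim

theorem exists_simpleFunc_tendstoUniformly {α E : Type*} [MeasurableSpace α]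
    [PseudoMetricSpace E] [ProperSpace E] [Nonempty E] [MeasurableSpace E]
    [OpensMeasurableSpace E] {F : α → E} (hF : Measurable F)
    (hb : Bornology.IsBounded (range F)) :
    ∃ φ : ℕ → SimpleFunc α E, TendstoUniformly (fun n => φ n) F atTop := by
  let e := TopologicalSpace.denseSeq E
  refine ⟨fun n => (SimpleFunc.nearestPt e n).comp F hF, ?_⟩
  refine Metric.tendstoUniformly_iff.2 fun ε hε => ?_
  obtain ⟨t, ht⟩ := hb.isCompact_closure.elim_finite_subcover
    (fun n => Metric.ball (e n) ε) (fun _ => Metric.isOpen_ball) fun z _ =>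
      mem_iUnion.2 ((TopologicalSpace.denseRange_denseSeq E).exists_dist_lt z hε)
  filter_upwards [eventually_ge_atTop (t.sup id)] with n hn z
  obtain ⟨k, hk, hkz⟩ := mem_iUnion₂.1 (ht (subset_closure (mem_range_self z)))
  have hnear := SimpleFunc.edist_nearestPt_le e (F z) ((Finset.le_sup (f := id) hk).trans hn)
  rw [edist_dist, edist_dist, ENNReal.ofReal_le_ofReal_iff dist_nonneg] at hnear
  rw [SimpleFunc.coe_comp, Function.comp_apply, dist_comm]
  exact hnear.trans_lt (Metric.mem_ball'.1 hkz)

end Analysis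

section Calculus

theorem uniqueDiffOn_of_ordConnected {I : Set ℝ} (hI : I.OrdConnected) (hI' : I.Nontrivial) :
    UniqueDiffOn ℝ I := by
  obtain ⟨a, ha, b, hb, hab⟩ := hI'.exists_lt
  refine uniqueDiffOn_convex hI.convex ((nonempty_Ioo.2 hab).mono ?_)
  exact interior_maximal (Ioo_subset_Icc_self.trans (hI.out ha hb)) isOpen_Ioo

theorem exists_Icc_mem_nhdsWithin {I : Set ℝ} {t : ℝ} (ht : t ∈ I) :
    ∃ a ∈ I, ∃ b ∈ I, t ∈ Icc a b ∧ Icc a b ∈ 𝓝[I] t := by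
  obtain ⟨a, ha, hat, ha'⟩ : ∃ a ∈ I, a ≤ t ∧ Ici a ∈ 𝓝[I] t := by
    by_cases! h : ∃ a ∈ I, a < t
    · obtain ⟨a, ha, hat⟩ := h
      exact ⟨a, ha, hat.le, nhdsWithin_le_nhds (Ici_mem_nhds hat)⟩
    · exact ⟨t, ht, le_rfl, eventually_nhdsWithin_of_forall h⟩
  obtain ⟨b, hb, htb, hb'⟩ : ∃ b ∈ I, t ≤ b ∧ Iic b ∈ 𝓝[I] t := by
    by_cases! h : ∃ b ∈ I, t < b
    · obtain ⟨b, hb, htb⟩ := h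
      exact ⟨b, hb, htb.le, nhdsWithin_le_nhds (Iic_mem_nhds htb)⟩
    · exact ⟨t, ht, le_rfl, eventually_nhdsWithin_of_forall h⟩
  exact ⟨a, ha, b, hb, ⟨hat, htb⟩, inter_mem ha' hb'⟩

variable {V : Type*} [NormedAddCommGroup V] [NormedSpace ℝ V] {s : Set ℝ}

theorem iteratedDerivWithin_eq_of_hasDerivWithinAt {v : ℕ → ℝ → V} (hs : UniqueDiffOn ℝ s)
    (hv : ∀ n, ∀ t ∈ s, HasDerivWithinAt (v n) (v (n + 1) t) s t) (n : ℕ) :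
    EqOn (iteratedDerivWithin n (v 0) s) (v n) s := by
  induction n with
  | zero => intro t _; rw [iteratedDerivWithin_zero]
  | succ n ih =>
    intro t ht
    rw [iteratedDerivWithin_succ, derivWithin_congr ih (ih ht)]
    exact (hv n t ht).derivWithin (hs t ht)

theorem contDiffOn_of_forall_hasDerivWithinAt {v : ℕ → ℝ → V} (hs : UniqueDiffOn ℝ s)
    (hv : ∀ n, ∀ t ∈ s, HasDerivWithinAt (v n) (v (n + 1) t) s t) : ContDiffOn ℝ ∞ (v 0) s :=
  contDiffOn_of_differentiableOn_deriv fun n _ => DifferentiableOn.congr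
    (fun t ht => (hv n t ht).differentiableWithinAt)
    (iteratedDerivWithin_eq_of_hasDerivWithinAt hs hv n)

theorem hasDerivWithinAt_iteratedDerivWithin {u : ℝ → V} (hu : ContDiffOn ℝ ∞ u s)
    (hs : UniqueDiffOn ℝ s) (n : ℕ) {t : ℝ} (ht : t ∈ s) :
    HasDerivWithinAt (iteratedDerivWithin n u s) (iteratedDerivWithin (n + 1) u s t) s t := by
  rw [iteratedDerivWithin_succ]
  exact (hu.differentiableOn_iteratedDerivWithin (by exact_mod_cast ENat.natCast_lt_top n) hs t
    ht).hasDerivWithinAt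

/-- A bounded family of operators detects norm derivatives as soon as it detects the norm, because
the mean value inequality holds uniformly over the family. -/
theorem hasDerivWithinAt_of_forall_clm {W ι : Type*} [NormedAddCommGroup W] [NormedSpace ℝ W]
    {L : ι → V →L[ℝ] W} {M : ℝ} (hM : 0 < M) (hLM : ∀ i, ‖L i‖ ≤ M)
    (hL : ∀ (x : V) (B : ℝ), (∀ i, ‖L i x‖ ≤ B) → ‖x‖ ≤ B) (hs : Convex ℝ s) {u w : ℝ → V}
    (hw : ContinuousOn w s)
    (hu : ∀ i, ∀ t ∈ s, HasDerivWithinAt (fun r => L i (u r)) (L i (w t)) s t)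
    {t : ℝ} (ht : t ∈ s) : HasDerivWithinAt u (w t) s t := by
  rw [hasDerivWithinAt_iff_isLittleO, Asymptotics.isLittleO_iff]
  intro ε hε
  obtain ⟨δ, hδ, hwδ⟩ := Metric.continuousWithinAt_iff.1 (hw t ht) (ε / M) (by positivity)
  filter_upwards [inter_mem_nhdsWithin s (Metric.ball_mem_nhds t hδ)] with r hr
  refine hL _ _ fun i => ?_
  have hderiv : ∀ q ∈ s ∩ Metric.ball t δ, HasDerivWithinAt (fun q => L i (u q) - q • L i (w t))
      (L i (w q - w t)) (s ∩ Metric.ball t δ) q := fun q hq => by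
    simpa using! ((hu i q hq.1).mono inter_subset_left).sub
      ((hasDerivWithinAt_id q _).smul_const (L i (w t)))
  have hbound : ∀ q ∈ s ∩ Metric.ball t δ, ‖L i (w q - w t)‖ ≤ ε := fun q hq => by
    calc ‖L i (w q - w t)‖ ≤ M * (ε / M) :=
          (L i).le_of_opNorm_le_of_le (hLM i) (by
            rw [← dist_eq_norm]; exact (hwδ hq.1 hq.2).le)
      _ = ε := mul_div_cancel₀ _ hM.ne'
  have hmv := (hs.inter (convex_ball t δ)).norm_image_sub_le_of_norm_hasDerivWithin_le
    hderiv hbound ⟨ht, Metric.mem_ball_self hδ⟩ hr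
  convert hmv using 2
  simp only [map_sub, map_smul, sub_smul]
  abel

theorem eq_exp_smul_apply_of_hasDerivWithinAt {X : Type*} [NormedAddCommGroup X]
    [NormedSpace ℂ X] [CompleteSpace X] {T : X →L[ℂ] X} {u : ℝ → X} (hs : Convex ℝ s)
    (hu : ∀ t ∈ s, HasDerivWithinAt u (T (u t)) s t) {a b : ℝ} (ha : a ∈ s) (hb : b ∈ s) :
    u b = NormedSpace.exp ((b - a) • T) (u a) := by
  have hexp (r : ℝ) : HasDerivAt (fun r => NormedSpace.exp ((b - r) • T))
      (-(NormedSpace.exp ((b - r) • T) * T)) r := by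
    simpa using! (hasDerivAt_exp_smul_const T (b - r)).scomp r ((hasDerivAt_id r).const_sub b)
  have hconst : ∀ r ∈ s,
      HasDerivWithinAt (fun r => NormedSpace.exp ((b - r) • T) (u r)) 0 s r := fun r hr => by
    simpa using! ((isBoundedBilinearMap_apply.hasFDerivAt (NormedSpace.exp ((b - r) • T),
      u r)).restrictScalars ℝ).comp_hasDerivWithinAt r
        ((hexp r).hasDerivWithinAt.prodMk (hu r hr))
  have h := hs.norm_image_sub_le_of_norm_hasDerivWithin_le hconst (C := 0) (by simp) ha hb
  rw [zero_mul] at h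
  simpa [NormedSpace.exp_zero] using sub_eq_zero.1 (norm_le_zero_iff.1 h)

end Calculus

variable {X : Type*} [NormedAddCommGroup X] [NormedSpace ℂ X]

namespace SpectralMeasure

variable (E : SpectralMeasure X)

theorem proj_empty : E.proj ∅ = 0 := by
  ext x
  have h := E.hasSum (fun _ => ∅) (fun _ => .empty) (fun _ _ _ => disjoint_bot_left) x
  simpa using (summable_const_iff (β := ℕ) (a := E.proj ∅ x)).1 (by simpa using h.summable)

open Classical in
/-- The vector measure `δ ↦ E(δ) x`; as Mathlib's vector measures do, it vanishes on the
non-measurable sets, on which `E.proj` is arbitrary. -/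
noncomputable def vectorMeasure (x : X) : VectorMeasure ℂ X where
  measureOf' s := if MeasurableSet s then E.proj s x else 0
  empty' := by simp [E.proj_empty]
  not_measurable' s hs := if_neg hs
  m_iUnion' f hf hd := by
    simpa [hf, MeasurableSet.iUnion hf] using E.hasSum f hf hd x

theorem vectorMeasure_apply (x : X) {s : Set ℂ} (hs : MeasurableSet s) :
    E.vectorMeasure x s = E.proj s x := if_pos hs

theorem proj_add_proj_compl {s : Set ℂ} (hs : MeasurableSet s) (x : X) :
    E.proj s x + E.proj sᶜ x = x := by
  have h := (E.vectorMeasure x).of_union disjoint_compl_right hs hs.compl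
  rw [union_compl_self, E.vectorMeasure_apply x .univ, E.vectorMeasure_apply x hs,
    E.vectorMeasure_apply x hs.compl, E.univ] at h
  exact h.symm

theorem proj_preimage_finset {α : Type*} (ψ : SimpleFunc ℂ α) (S : Finset α) :
    E.proj (ψ ⁻¹' S) = ∑ a ∈ S, E.proj (ψ ⁻¹' {a}) := by
  ext x
  have h := (E.vectorMeasure x).of_biUnion_finset (s := S) (f := fun a => ψ ⁻¹' {a})
    (fun a _ b _ hab => (disjoint_singleton.2 hab).preimage ψ) (fun a _ => ψ.measurableSet_fiber a)
  rw [show (⋃ b ∈ S, ψ ⁻¹' {b}) = ψ ⁻¹' S by ext; simp,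
    E.vectorMeasure_apply x (ψ.measurableSet_preimage _)] at h
  simp only [E.vectorMeasure_apply x (ψ.measurableSet_fiber _)] at h
  simpa using h

theorem exists_norm_proj_le [CompleteSpace X] :
    ∃ M > 0, ∀ s, MeasurableSet s → ‖E.proj s‖ ≤ M := by
  obtain ⟨M, hM⟩ := banach_steinhaus (g := fun s : {s : Set ℂ // MeasurableSet s} => E.proj s)
    fun x => ⟨(E.vectorMeasure x).bound, fun s => by
      rw [← E.vectorMeasure_apply x s.2]; exact VectorMeasure.norm_apply_le_bound⟩
  exact ⟨max M 1, by positivity, fun s hs => (hM ⟨s, hs⟩).trans (le_max_left _ _)⟩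

theorem simpleIntegral_map {α : Type*} (ψ : SimpleFunc ℂ α) (f : α → ℂ) :
    E.simpleIntegral (ψ.map f) = ∑ a ∈ ψ.range, f a • E.proj (ψ ⁻¹' {a}) := by
  classical
  rw [simpleIntegral, SimpleFunc.range_map,
    ← Finset.sum_fiberwise_of_maps_to fun a ha => Finset.mem_image_of_mem f ha]
  refine Finset.sum_congr rfl fun c _ => ?_
  rw [SimpleFunc.map_preimage_singleton, proj_preimage_finset, Finset.smul_sum]
  refine Finset.sum_congr rfl fun a ha => ?_
  rw [(Finset.mem_filter.1 ha).2]

theorem simpleIntegral_eq_sum_pair (φ ψ : SimpleFunc ℂ ℂ) :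
    E.simpleIntegral φ =
        ∑ p ∈ (φ.pair ψ).range, p.1 • E.proj (φ.pair ψ ⁻¹' {p}) ∧
      E.simpleIntegral ψ = ∑ p ∈ (φ.pair ψ).range, p.2 • E.proj (φ.pair ψ ⁻¹' {p}) := by
  rw [← simpleIntegral_map, ← simpleIntegral_map, SimpleFunc.map_fst_pair,
    SimpleFunc.map_snd_pair]
  exact ⟨rfl, rfl⟩

theorem simpleIntegral_add (φ ψ : SimpleFunc ℂ ℂ) :
    E.simpleIntegral (φ + ψ) = E.simpleIntegral φ + E.simpleIntegral ψ := by
  obtain ⟨hφ, hψ⟩ := E.simpleIntegral_eq_sum_pair φ ψ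
  rw [hφ, hψ, ← Finset.sum_add_distrib]
  simp only [← add_smul]
  exact E.simpleIntegral_map (φ.pair ψ) fun p => p.1 + p.2

theorem simpleIntegral_sub (φ ψ : SimpleFunc ℂ ℂ) :
    E.simpleIntegral (φ - ψ) = E.simpleIntegral φ - E.simpleIntegral ψ := by
  rw [eq_sub_iff_add_eq, ← simpleIntegral_add, sub_add_cancel]

theorem proj_fiber_mul_proj_fiber_of_ne {α : Type*} (ψ : SimpleFunc ℂ α) {p q : α} (h : p ≠ q) :
    E.proj (ψ ⁻¹' {p}) * E.proj (ψ ⁻¹' {q}) = 0 := by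
  rw [ContinuousLinearMap.mul_def,
    ← E.inter _ _ (ψ.measurableSet_fiber p) (ψ.measurableSet_fiber q), ← preimage_inter,
    singleton_inter_eq_empty.2 (by simpa using h), preimage_empty, E.proj_empty]

theorem proj_mul_self {s : Set ℂ} (hs : MeasurableSet s) : E.proj s * E.proj s = E.proj s := by
  rw [ContinuousLinearMap.mul_def, ← E.inter s s hs hs, inter_self]

theorem simpleIntegral_mul (φ ψ : SimpleFunc ℂ ℂ) :
    E.simpleIntegral (φ * ψ) = E.simpleIntegral φ * E.simpleIntegral ψ := by
  obtain ⟨hφ, hψ⟩ := E.simpleIntegral_eq_sum_pair φ ψ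
  rw [hφ, hψ, Finset.sum_mul_sum]
  refine (E.simpleIntegral_map (φ.pair ψ) fun p => p.1 * p.2).trans
    (Finset.sum_congr rfl fun p hp => ?_)
  rw [Finset.sum_eq_single_of_mem p hp fun q _ hq => by
    rw [smul_mul_smul_comm, proj_fiber_mul_proj_fiber_of_ne E _ hq.symm, smul_zero]]
  rw [smul_mul_smul_comm, proj_mul_self E (SimpleFunc.measurableSet_fiber _ _)]

theorem simpleIntegral_const (c : ℂ) : E.simpleIntegral (SimpleFunc.const ℂ c) = c • 1 := by
  rw [simpleIntegral, SimpleFunc.range_const]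
  simp [show Function.const ℂ c ⁻¹' {c} = Set.univ by ext; simp, E.univ,
    ContinuousLinearMap.one_def]

theorem simpleIntegral_indicator {s : Set ℂ} (hs : MeasurableSet s) :
    E.simpleIntegral (SimpleFunc.piecewise s hs (SimpleFunc.const ℂ 1) (SimpleFunc.const ℂ 0)) =
      E.proj s := by
  rw [simpleIntegral, Finset.sum_subset (s₂ := {0, 1})]
  · rw [Finset.sum_pair zero_ne_one, zero_smul, zero_add, one_smul]
    congr 1
    ext z
    by_cases hz : z ∈ s <;> simp [hz]
  · refine SimpleFunc.forall_mem_range.2 fun z => ?_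
    by_cases hz : z ∈ s <;> simp [hz]
  · intro c _ hc
    rw [(SimpleFunc.preimage_eq_empty_iff _ c).2 hc, E.proj_empty, smul_zero]

theorem norm_simpleIntegral_le {M : ℝ} (hM : ∀ s, MeasurableSet s → ‖E.proj s‖ ≤ M)
    {φ : SimpleFunc ℂ ℂ} {B : ℝ} (hB : ∀ z, ‖φ z‖ ≤ B) :
    ‖E.simpleIntegral φ‖ ≤ 4 * M * B := by
  refine norm_sum_complex_smul_le (fun t _ => ?_) ((norm_nonneg _).trans (hB 0))
    (SimpleFunc.forall_mem_range.2 hB)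
  rw [← proj_preimage_finset]
  exact hM _ (φ.measurableSet_preimage _)

variable {E}

theorem hasBoundedIntegral_iff_mem_closure {F : ℂ → ℂ} {T : X →L[ℂ] X} :
    E.HasBoundedIntegral F T ↔ (UniformFun.ofFun F, T) ∈
      closure (range fun φ : SimpleFunc ℂ ℂ => (UniformFun.ofFun ⇑φ, E.simpleIntegral φ)) := by
  rw [mem_closure_iff_seq_limit]
  constructor
  · rintro ⟨φ, hφ, hT⟩
    exact ⟨_, fun n => mem_range_self (φ n),
      (UniformFun.tendsto_iff_tendstoUniformly.2 hφ).prodMk_nhds hT⟩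
  · rintro ⟨p, hp, hlim⟩
    choose φ hφ using hp
    simp only [← funext hφ] at hlim
    obtain ⟨h₁, h₂⟩ := Prod.tendsto_iff .. |>.1 hlim
    exact ⟨φ, UniformFun.tendsto_iff_tendstoUniformly.1 h₁, h₂⟩

theorem hasBoundedIntegral_simpleFunc (φ : SimpleFunc ℂ ℂ) :
    E.HasBoundedIntegral φ (E.simpleIntegral φ) :=
  hasBoundedIntegral_iff_mem_closure.2 (subset_closure (mem_range_self φ))

theorem hasBoundedIntegral_const (c : ℂ) : E.HasBoundedIntegral (fun _ => c) (c • 1) :=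
  E.simpleIntegral_const c ▸ hasBoundedIntegral_simpleFunc (SimpleFunc.const ℂ c)

theorem hasBoundedIntegral_indicator {s : Set ℂ} (hs : MeasurableSet s) :
    E.HasBoundedIntegral (s.indicator 1) (E.proj s) := by
  classical
  rw [← E.simpleIntegral_indicator hs, ← piecewise_eq_indicator]
  exact hasBoundedIntegral_simpleFunc (E := E)
    (SimpleFunc.piecewise s hs (SimpleFunc.const ℂ 1) (SimpleFunc.const ℂ 0))

namespace HasBoundedIntegral

variable {F G : ℂ → ℂ} {T S : X →L[ℂ] X}

theorem measurable (h : E.HasBoundedIntegral F T) : Measurable F := by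
  obtain ⟨φ, hφ, -⟩ := h
  exact measurable_of_tendsto_metrizable (fun n => (φ n).measurable)
    (tendsto_pi_nhds.2 hφ.tendsto_at)

theorem exists_norm_le (h : E.HasBoundedIntegral F T) : ∃ B, ∀ z, ‖F z‖ ≤ B := by
  obtain ⟨φ, hφ, -⟩ := h
  obtain ⟨n, hn⟩ := (Metric.tendstoUniformly_iff.1 hφ 1 one_pos).exists
  obtain ⟨C, hC⟩ := ((φ n).map fun c => ‖c‖).exists_forall_le
  refine ⟨C + 1, fun z => ?_⟩
  have hφC : ‖φ n z‖ ≤ C := hC z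
  have hFφ : ‖F z - φ n z‖ < 1 := dist_eq_norm (F z) (φ n z) ▸ hn z
  linarith [norm_le_norm_add_norm_sub' (F z) (φ n z)]

theorem of_tendstoUniformly {F' : ℕ → ℂ → ℂ} {T' : ℕ → X →L[ℂ] X}
    (h : ∀ n, E.HasBoundedIntegral (F' n) (T' n)) (hF : TendstoUniformly F' F atTop)
    (hT : Tendsto T' atTop (𝓝 T)) : E.HasBoundedIntegral F T := by
  simp only [hasBoundedIntegral_iff_mem_closure] at h ⊢
  exact isClosed_closure.mem_of_tendsto
    ((UniformFun.tendsto_iff_tendstoUniformly.2 hF).prodMk_nhds hT) (.of_forall h)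

theorem add (hF : E.HasBoundedIntegral F T) (hG : E.HasBoundedIntegral G S) :
    E.HasBoundedIntegral (F + G) (T + S) := by
  obtain ⟨φ, hφ, hT⟩ := hF
  obtain ⟨ψ, hψ, hS⟩ := hG
  exact ⟨fun n => φ n + ψ n, hφ.add hψ, by simpa only [simpleIntegral_add] using hT.add hS⟩

theorem sub (hF : E.HasBoundedIntegral F T) (hG : E.HasBoundedIntegral G S) :
    E.HasBoundedIntegral (F - G) (T - S) := by
  obtain ⟨φ, hφ, hT⟩ := hF
  obtain ⟨ψ, hψ, hS⟩ := hG
  exact ⟨fun n => φ n - ψ n, hφ.sub hψ, by simpa only [simpleIntegral_sub] using hT.sub hS⟩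

theorem mul (hF : E.HasBoundedIntegral F T) (hG : E.HasBoundedIntegral G S) :
    E.HasBoundedIntegral (F * G) (T * S) := by
  obtain ⟨BF, hBF⟩ := hF.exists_norm_le
  obtain ⟨BG, hBG⟩ := hG.exists_norm_le
  obtain ⟨φ, hφ, hT⟩ := hF
  obtain ⟨ψ, hψ, hS⟩ := hG
  exact ⟨fun n => φ n * ψ n, tendstoUniformly_mul_of_norm_le hφ hψ hBF hBG,
    by simpa only [simpleIntegral_mul] using hT.mul hS⟩

theorem const_smul (c : ℂ) (hF : E.HasBoundedIntegral F T) :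
    E.HasBoundedIntegral (c • F) (c • T) := by
  have h := (hasBoundedIntegral_const (E := E) c).mul hF
  rwa [smul_mul_assoc, one_mul] at h

theorem pow (hF : E.HasBoundedIntegral F T) (n : ℕ) : E.HasBoundedIntegral (F ^ n) (T ^ n) := by
  induction n with
  | zero => simpa using! hasBoundedIntegral_const (E := E) 1
  | succ n ih => simpa only [pow_succ] using ih.mul hF

theorem sum {ι : Type*} (s : Finset ι) {F : ι → ℂ → ℂ} {T : ι → X →L[ℂ] X}
    (h : ∀ i ∈ s, E.HasBoundedIntegral (F i) (T i)) :
    E.HasBoundedIntegral (∑ i ∈ s, F i) (∑ i ∈ s, T i) := by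
  classical
  induction s using Finset.induction_on with
  | empty => simpa using! hasBoundedIntegral_const (E := E) 0
  | insert i s hi ih =>
    rw [Finset.sum_insert hi, Finset.sum_insert hi]
    exact (h i (Finset.mem_insert_self _ _)).add
      (ih fun j hj => h j (Finset.mem_insert_of_mem hj))

theorem exp [CompleteSpace X] (hF : E.HasBoundedIntegral F T) :
    E.HasBoundedIntegral (fun z => Complex.exp (F z)) (NormedSpace.exp T) := by
  obtain ⟨B, hB⟩ := hF.exists_norm_le
  have hlim : TendstoUniformly (fun N => ∑ n ∈ Finset.range N, ((n.factorial : ℂ)⁻¹) • F ^ n)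
      (fun z => Complex.exp (F z)) atTop := by
    convert! tendstoUniformly_tsum_nat (f := fun n z => ((n.factorial : ℂ)⁻¹) • F z ^ n)
      (Real.summable_pow_div_factorial B) fun n z => ?_ using 2 with N z
    · ext z; simp
    · rw [Complex.exp_eq_exp_ℂ, NormedSpace.exp_eq_tsum ℂ]
    · rw [norm_smul, norm_inv, norm_pow, Complex.norm_natCast, inv_mul_eq_div]
      gcongr
      exact hB z
  exact of_tendstoUniformly (fun N => sum _ fun n _ => (hF.pow n).const_smul _) hlim
    (NormedSpace.exp_series_hasSum_exp' (𝕂 := ℂ) T).tendsto_sum_nat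

end HasBoundedIntegral

variable (E) in
theorem exists_norm_le_of_hasBoundedIntegral [CompleteSpace X] :
    ∃ C > 0, ∀ {F : ℂ → ℂ} {T : X →L[ℂ] X} {B : ℝ}, E.HasBoundedIntegral F T →
      (∀ z, ‖F z‖ ≤ B) → ‖T‖ ≤ C * B := by
  obtain ⟨M, hM0, hM⟩ := E.exists_norm_proj_le
  refine ⟨4 * M, by positivity, fun {F T B} ⟨φ, hφ, hT⟩ hB => ?_⟩
  have hlim : Tendsto (fun ε => 4 * M * (B + ε)) (𝓝[>] 0) (𝓝 (4 * M * B)) := by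
    have hcont : Continuous fun ε => 4 * M * (B + ε) := by fun_prop
    simpa using (hcont.tendsto 0).mono_left nhdsWithin_le_nhds
  refine ge_of_tendsto hlim (eventually_mem_nhdsWithin.mono fun ε hε => ?_)
  refine le_of_tendsto hT.norm ((Metric.tendstoUniformly_iff.1 hφ ε hε).mono fun n hn => ?_)
  refine E.norm_simpleIntegral_le hM fun z => ?_
  have hFφ : ‖F z - φ n z‖ < ε := dist_eq_norm (F z) (φ n z) ▸ hn z
  linarith [hB z, norm_le_norm_add_norm_sub (F z) (φ n z)]

theorem HasBoundedIntegral.unique [CompleteSpace X] {F : ℂ → ℂ} {T S : X →L[ℂ] X}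
    (hT : E.HasBoundedIntegral F T) (hS : E.HasBoundedIntegral F S) : T = S := by
  obtain ⟨C, -, hC⟩ := E.exists_norm_le_of_hasBoundedIntegral
  have h : ‖T - S‖ ≤ C * 0 := hC (hT.sub hS) (by simp)
  rwa [mul_zero, norm_le_zero_iff, sub_eq_zero] at h

theorem exists_hasBoundedIntegral [CompleteSpace X] {F : ℂ → ℂ} (hF : Measurable F)
    (hb : Bornology.IsBounded (range F)) : ∃ T, E.HasBoundedIntegral F T := by
  obtain ⟨C, hC, hnorm⟩ := E.exists_norm_le_of_hasBoundedIntegral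
  obtain ⟨φ, hφ⟩ := exists_simpleFunc_tendstoUniformly hF hb
  have hcauchy : CauchySeq fun n => E.simpleIntegral (φ n) := by
    refine Metric.cauchySeq_iff.2 fun ε hε => ?_
    obtain ⟨N, hN⟩ := Metric.uniformCauchySeqOn_iff.1
      (tendstoUniformlyOn_univ.2 hφ).uniformCauchySeqOn (ε / (2 * C)) (by positivity)
    refine ⟨N, fun m hm n hn => ?_⟩
    rw [dist_eq_norm]
    calc ‖E.simpleIntegral (φ m) - E.simpleIntegral (φ n)‖ ≤ C * (ε / (2 * C)) :=
          hnorm ((hasBoundedIntegral_simpleFunc (φ m)).sub (hasBoundedIntegral_simpleFunc (φ n)))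
            fun z => by
              rw [Pi.sub_apply, ← dist_eq_norm]
              exact (hN m hm n hn z (mem_univ z)).le
      _ = ε / 2 := by field_simp
      _ < ε := half_lt_self hε
  obtain ⟨T, hT⟩ := cauchySeq_tendsto_of_complete hcauchy
  exact ⟨T, φ, hφ, hT⟩

variable (E) in
theorem exists_norm_le_endpoints_of_hasDerivWithinAt [CompleteSpace X] :
    ∃ C > 0, ∀ {F : ℂ → ℂ} {T : X →L[ℂ] X}, E.HasBoundedIntegral F T → ∀ {u : ℝ → X} {a b : ℝ},
      (∀ t ∈ Icc a b, HasDerivWithinAt u (T (u t)) (Icc a b) t) →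
        ∀ t ∈ Icc a b, ‖u t‖ ≤ C * (‖u a‖ + ‖u b‖) := by
  obtain ⟨C, hC, hnorm⟩ := E.exists_norm_le_of_hasBoundedIntegral
  refine ⟨C, hC, fun {F T} hF {u a b} hu t ht => ?_⟩
  have hle : a ≤ b := ht.1.trans ht.2
  have hflow (S : Set ℂ) (hS : MeasurableSet S) (r : ℝ) (hr : ∀ z ∈ S, r * (F z).re ≤ 0) :
      ‖E.proj S * NormedSpace.exp (r • T)‖ ≤ C := by
    rw [← mul_one C, ← Complex.coe_smul]
    refine hnorm ((hasBoundedIntegral_indicator hS).mul (hF.const_smul r).exp) fun z => ?_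
    by_cases hz : z ∈ S
    · simpa [hz, Complex.norm_exp] using hr z hz
    · simp [hz]
  have hP : MeasurableSet {z | (F z).re ≤ 0} :=
    measurableSet_le (Complex.measurable_re.comp hF.measurable) measurable_const
  have hdecay := hflow _ hP (t - a) fun z hz =>
    mul_nonpos_of_nonneg_of_nonpos (sub_nonneg.2 ht.1) hz
  have hgrowth := hflow _ hP.compl (t - b) fun z hz =>
    mul_nonpos_of_nonpos_of_nonneg (sub_nonpos.2 ht.2) (by simpa using hz : 0 < (F z).re).le
  have hflow_left := eq_exp_smul_apply_of_hasDerivWithinAt (convex_Icc a b) hu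
    (left_mem_Icc.2 hle) ht
  have hflow_right := eq_exp_smul_apply_of_hasDerivWithinAt (convex_Icc a b) hu
    (right_mem_Icc.2 hle) ht
  calc ‖u t‖ ≤ ‖E.proj {z | (F z).re ≤ 0} (u t)‖ + ‖E.proj {z | (F z).re ≤ 0}ᶜ (u t)‖ := by
        conv_lhs => rw [← E.proj_add_proj_compl hP (u t)]
        exact norm_add_le _ _
    _ ≤ C * ‖u a‖ + C * ‖u b‖ := by
        refine add_le_add ?_ ?_
        · rw [hflow_left]
          exact ContinuousLinearMap.le_of_opNorm_le _ hdecay (u a)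
        · rw [hflow_right]
          exact ContinuousLinearMap.le_of_opNorm_le _ hgrowth (u b)
    _ = C * (‖u a‖ + ‖u b‖) := (mul_add _ _ _).symm

section Truncation

variable (E)

theorem measurableSet_norm_le (k : ℕ) : MeasurableSet {z : ℂ | ‖z‖ ≤ k} :=
  measurableSet_le measurable_norm measurable_const

/-- The spectral projection of the closed disc of radius `k`. -/
noncomputable def truncProj (k : ℕ) : X →L[ℂ] X := E.proj {z | ‖z‖ ≤ k}

theorem hasBoundedIntegral_truncProj (k : ℕ) :
    E.HasBoundedIntegral ({z | ‖z‖ ≤ k}.indicator 1) (E.truncProj k) :=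
  hasBoundedIntegral_indicator (measurableSet_norm_le k)

theorem tendsto_truncProj (x : X) : Tendsto (fun k => E.truncProj k x) atTop (𝓝 x) := by
  have hmono : Monotone fun k : ℕ => {z : ℂ | ‖z‖ ≤ k} :=
    fun i j hij z (hz : ‖z‖ ≤ i) => show ‖z‖ ≤ j from hz.trans (Nat.cast_le.2 hij)
  have hunion : ⋃ k : ℕ, {z : ℂ | ‖z‖ ≤ k} = Set.univ :=
    eq_univ_of_forall fun z => mem_iUnion.2 (exists_nat_ge ‖z‖)
  have h := VectorMeasure.tendsto_vectorMeasure_iUnion_atTop_nat (v := E.vectorMeasure x)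
    hmono measurableSet_norm_le
  rw [hunion, E.vectorMeasure_apply x .univ, E.univ] at h
  exact h.congr fun k => E.vectorMeasure_apply x (measurableSet_norm_le k)

theorem norm_le_of_forall_norm_truncProj_le {x : X} {B : ℝ} (h : ∀ k, ‖E.truncProj k x‖ ≤ B) :
    ‖x‖ ≤ B :=
  le_of_tendsto' (E.tendsto_truncProj x).norm h

variable [CompleteSpace X]

theorem exists_norm_truncProj_le : ∃ M > 0, ∀ k, ‖E.truncProj k‖ ≤ M := by
  obtain ⟨M, hM0, hM⟩ := E.exists_norm_proj_le
  exact ⟨M, hM0, fun k => hM _ (measurableSet_norm_le k)⟩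

theorem exists_hasBoundedIntegral_indicator_norm_le (k : ℕ) :
    ∃ T, E.HasBoundedIntegral ({z | ‖z‖ ≤ k}.indicator fun z => z) T := by
  refine exists_hasBoundedIntegral (measurable_id.indicator (measurableSet_norm_le k))
    (isBounded_iff_forall_norm_le.2 ⟨k, ?_⟩)
  rintro _ ⟨z, rfl⟩
  by_cases hz : ‖z‖ ≤ k <;> simp [indicator, hz]

/-- The bounded operator `∫ z dE(z)` over the closed disc of radius `k`. -/
noncomputable def truncOp (k : ℕ) : X →L[ℂ] X :=
  (E.exists_hasBoundedIntegral_indicator_norm_le k).choose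

theorem hasBoundedIntegral_truncOp (k : ℕ) :
    E.HasBoundedIntegral ({z | ‖z‖ ≤ k}.indicator fun z => z) (E.truncOp k) :=
  (E.exists_hasBoundedIntegral_indicator_norm_le k).choose_spec

theorem truncProj_truncOp {k n : ℕ} (h : k ≤ n) (x : X) :
    E.truncProj k (E.truncOp n x) = E.truncOp k x := by
  suffices E.truncProj k * E.truncOp n = E.truncOp k from DFunLike.congr_fun this x
  refine ((E.hasBoundedIntegral_truncProj k).mul (E.hasBoundedIntegral_truncOp n)).unique ?_
  convert E.hasBoundedIntegral_truncOp k using 1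
  ext z
  by_cases hz : ‖z‖ ≤ k
  · simp [indicator, hz, hz.trans (Nat.cast_le.2 h)]
  · simp [indicator, hz]

theorem truncOp_truncProj (k : ℕ) (x : X) : E.truncOp k (E.truncProj k x) = E.truncOp k x := by
  suffices E.truncOp k * E.truncProj k = E.truncOp k from DFunLike.congr_fun this x
  refine ((E.hasBoundedIntegral_truncOp k).mul (E.hasBoundedIntegral_truncProj k)).unique ?_
  convert E.hasBoundedIntegral_truncOp k using 1
  ext z
  by_cases hz : ‖z‖ ≤ k <;> simp [indicator, hz]

theorem hasIntegralAt_id_iff {x v : X} :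
    E.HasIntegralAt (fun z => z) x v ↔ Tendsto (fun k => E.truncOp k x) atTop (𝓝 v) := by
  constructor
  · rintro ⟨T, hT, h⟩
    simpa only [(hT _).unique (E.hasBoundedIntegral_truncOp _)] using h
  · exact fun h => ⟨E.truncOp, E.hasBoundedIntegral_truncOp, h⟩

/-- The spectral truncations of `w` solve the truncations of `w' = A w` on `I`, where `A = ∫ z dE`.
Unlike the equation itself, this makes sense without `w t ∈ D(A)`. -/
def IsTruncSolutionOn (w : ℝ → X) (I : Set ℝ) : Prop :=
  ∀ k, ∀ t ∈ I, HasDerivWithinAt (fun s => E.truncProj k (w s)) (E.truncOp k (w t)) I t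

namespace IsTruncSolutionOn

variable {E} {w : ℝ → X} {I : Set ℝ}

theorem mono {J : Set ℝ} (hw : E.IsTruncSolutionOn w I) (hJ : J ⊆ I) : E.IsTruncSolutionOn w J :=
  fun k t ht => (hw k t (hJ ht)).mono hJ

theorem congr {w' : ℝ → X} (hw : E.IsTruncSolutionOn w I) (h : EqOn w' w I) :
    E.IsTruncSolutionOn w' I := fun k t ht => by
  rw [h ht]
  exact (hw k t ht).congr (fun s hs => by rw [h hs]) (by rw [h ht])

variable (E) in
theorem exists_norm_le_endpoints :
    ∃ C > 0, ∀ {w : ℝ → X} {a b : ℝ}, E.IsTruncSolutionOn w (Icc a b) →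
      ∀ t ∈ Icc a b, ‖w t‖ ≤ C * (‖w a‖ + ‖w b‖) := by
  obtain ⟨C, hC, hbound⟩ := E.exists_norm_le_endpoints_of_hasDerivWithinAt
  refine ⟨C, hC, fun {w a b} hw t ht => ?_⟩
  refine le_of_tendsto_of_tendsto' (E.tendsto_truncProj _).norm
    (((E.tendsto_truncProj _).norm.add (E.tendsto_truncProj _).norm).const_mul C) fun k => ?_
  refine hbound (E.hasBoundedIntegral_truncOp k) (u := fun s => E.truncProj k (w s))
    (fun s hs => ?_) t ht
  rw [E.truncOp_truncProj]
  exact hw k s hs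

end IsTruncSolutionOn

end Truncation

end SpectralMeasure

/-- Weak solutions of `y' = A y` on a set `I` of times, with one-sided derivatives at endpoints of
`I`; `IsWeakSolution` is the case `I = [0, ∞)`. -/
def IsWeakSolutionOn (A : X →ₗ.[ℂ] X) (y : ℝ → X) (I : Set ℝ) : Prop :=
  ContinuousOn y I ∧ ∀ g h : StrongDual ℂ X, HasAdjointAt A g h →
    ∀ t ∈ I, HasDerivWithinAt (fun s => g (y s)) (h (y t)) I t

theorem IsWeakSolution.isWeakSolutionOn {A : X →ₗ.[ℂ] X} {y : ℝ → X} {I : Set ℝ}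
    (hy : IsWeakSolution A y) (hI : I ⊆ Ici 0) : IsWeakSolutionOn A y I :=
  ⟨hy.1.mono hI, fun g h hgh t ht => (hy.2 g h hgh t (hI ht)).mono hI⟩

section Powers

variable {A B : X →ₗ.[ℂ] X} {x v : X}

theorem mem_graph_opPow_zero : (x, v) ∈ (opPow A 0).graph ↔ x = v := by
  simp [LinearPMap.mem_graph_iff, opPow]

theorem mem_graph_opMul :
    (x, v) ∈ (opMul B A).graph ↔ ∃ w, (x, w) ∈ A.graph ∧ (w, v) ∈ B.graph := by
  simp only [LinearPMap.mem_graph_iff]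
  constructor
  · rintro ⟨⟨_, z, hz, rfl⟩, rfl, rfl⟩
    exact ⟨A z, ⟨z, rfl, rfl⟩, ⟨A z, hz⟩, rfl, rfl⟩
  · rintro ⟨_, ⟨z, rfl, rfl⟩, ⟨w, hw, rfl⟩⟩
    refine ⟨⟨z, z, show A z ∈ B.domain from hw ▸ w.2, rfl⟩, rfl, ?_⟩
    change B ⟨A z, _⟩ = B w
    congr 1
    exact Subtype.ext hw.symm

theorem mem_graph_opPow_of_forall_mem_graph {v : ℕ → X} (hv : ∀ n, (v n, v (n + 1)) ∈ A.graph)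
    (n : ℕ) : (v 0, v n) ∈ (opPow A n).graph := by
  induction n with
  | zero => exact mem_graph_opPow_zero.2 rfl
  | succ n ih => exact mem_graph_opMul.2 ⟨v n, ih, hv n⟩

theorem exists_orbit_of_forall_mem_domain_opPow (hx : ∀ n, x ∈ (opPow A n).domain) :
    ∃ v : ℕ → X, v 0 = x ∧ ∀ n, (v n, v (n + 1)) ∈ A.graph := by
  have hv (n : ℕ) : (x, opPow A n ⟨x, hx n⟩) ∈ (opPow A n).graph := (opPow A n).mem_graph ⟨x, hx n⟩
  refine ⟨fun n => opPow A n ⟨x, hx n⟩, (mem_graph_opPow_zero.1 (hv 0)).symm, fun n => ?_⟩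
  obtain ⟨w, hw, hwA⟩ := mem_graph_opMul.1 (hv (n + 1))
  rwa [LinearPMap.mem_graph_snd_inj _ hw (hv n) rfl] at hwA

theorem exists_eq_apply_of_mem_graph (h : (x, v) ∈ A.graph) : ∃ hx : x ∈ A.domain, v = A ⟨x, hx⟩ :=
  ⟨A.mem_domain_of_mem_graph h, (LinearPMap.image_iff (A.mem_domain_of_mem_graph h)).2 h⟩

end Powers

namespace IsSpectralMeasureOf

variable [CompleteSpace X] {A : X →ₗ.[ℂ] X} {E : SpectralMeasure X}

theorem mem_graph_iff_forall_truncProj_eq (hA : IsSpectralMeasureOf E A) {x v : X} :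
    (x, v) ∈ A.graph ↔ ∀ k, E.truncProj k v = E.truncOp k x := by
  rw [hA.mem_graph_iff, E.hasIntegralAt_id_iff]
  refine ⟨fun h k => ?_, fun h => by simpa only [h] using E.tendsto_truncProj v⟩
  refine tendsto_nhds_unique (((E.truncProj k).continuous.tendsto v).comp h)
    (tendsto_const_nhds.congr' ?_)
  filter_upwards [eventually_ge_atTop k] with n hn
  exact (E.truncProj_truncOp hn x).symm

variable {I : Set ℝ} {y w w' : ℝ → X}

/-- Since `g ∘ truncProj k ∈ D(A*)` for every functional `g`, the truncations of a weak solution are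
differentiable in norm. -/
theorem isTruncSolutionOn_of_isWeakSolutionOn (hA : IsSpectralMeasureOf E A)
    (hI : Convex ℝ I) (hy : IsWeakSolutionOn A y I) : E.IsTruncSolutionOn y I := by
  intro k t ht
  refine hasDerivWithinAt_of_forall_clm (w := fun s => E.truncOp k (y s)) one_pos
    (L := fun g : {g : StrongDual ℂ X // ‖g‖ ≤ 1} => g.1.restrictScalars ℝ)
    (fun g => (g.1.norm_restrictScalars).trans_le g.2) (fun x B hB => ?_) hI
    ((E.truncOp k).continuous.comp_continuousOn hy.1) (fun g s hs => ?_) ht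
  · obtain ⟨g, hg, hgx⟩ := exists_dual_vector'' ℂ x
    simpa [hgx] using hB ⟨g, hg⟩
  · exact hy.2 (g.1.comp (E.truncProj k)) (g.1.comp (E.truncOp k)) (fun x => congrArg g.1
      (hA.mem_graph_iff_forall_truncProj_eq.1 (A.mem_graph x) k)) s hs

theorem isTruncSolutionOn_of_mem_graph (hA : IsSpectralMeasureOf E A)
    (hw : E.IsTruncSolutionOn w I) (hww' : ∀ t ∈ I, (w t, w' t) ∈ A.graph) :
    E.IsTruncSolutionOn w' I := by
  intro k t ht
  have heq : ∀ s ∈ I, E.truncProj k (w' s) = E.truncOp k (E.truncProj k (w s)) := fun s hs => by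
    rw [E.truncOp_truncProj, hA.mem_graph_iff_forall_truncProj_eq.1 (hww' s hs) k]
  have hderiv := ((E.truncOp k).hasFDerivAt.restrictScalars ℝ).comp_hasDerivWithinAt t (hw k t ht)
  rw [← hA.mem_graph_iff_forall_truncProj_eq.1 (hww' t ht) k] at hderiv
  rw [← E.truncOp_truncProj]
  exact hderiv.congr heq (heq t ht)

theorem mem_graph_of_hasDerivWithinAt (hA : IsSpectralMeasureOf E A)
    (hI : UniqueDiffOn ℝ I) (hw : E.IsTruncSolutionOn w I) {t : ℝ} (ht : t ∈ I) {v : X}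
    (hv : HasDerivWithinAt w v I t) : (w t, v) ∈ A.graph :=
  hA.mem_graph_iff_forall_truncProj_eq.2 fun k => (hI t ht).eq_deriv _
    (((E.truncProj k).hasFDerivAt.restrictScalars ℝ).comp_hasDerivWithinAt t hv) (hw k t ht)

theorem continuousOn_of_mem_graph (hA : IsSpectralMeasureOf E A)
    (hI : I.OrdConnected) (hw : E.IsTruncSolutionOn w I)
    (hww' : ∀ t ∈ I, (w t, w' t) ∈ A.graph) : ContinuousOn w I := by
  intro t ht
  obtain ⟨a, ha, b, hb, htab, hnhds⟩ := exists_Icc_mem_nhdsWithin ht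
  have hsub : Icc a b ⊆ I := hI.out ha hb
  obtain ⟨C, -, hC⟩ := SpectralMeasure.IsTruncSolutionOn.exists_norm_le_endpoints E
  obtain ⟨M, -, hM⟩ := E.exists_norm_truncProj_le
  have hw'_bound := hC ((hA.isTruncSolutionOn_of_mem_graph hw hww').mono hsub)
  have hderiv_bound (k : ℕ) : ∀ s ∈ Icc a b,
      ‖E.truncOp k (w s)‖ ≤ M * (C * (‖w' a‖ + ‖w' b‖)) := fun s hs => by
    rw [← hA.mem_graph_iff_forall_truncProj_eq.1 (hww' s (hsub hs)) k]
    exact (E.truncProj k).le_of_opNorm_le_of_le (hM k) (hw'_bound s hs)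
  have hlip : ∀ s ∈ Icc a b, ‖w s - w t‖ ≤ M * (C * (‖w' a‖ + ‖w' b‖)) * ‖s - t‖ := fun s hs =>
    E.norm_le_of_forall_norm_truncProj_le fun k => by
      rw [map_sub]
      exact (convex_Icc a b).norm_image_sub_le_of_norm_hasDerivWithin_le (hw.mono hsub k)
        (hderiv_bound k) htab hs
  rw [ContinuousWithinAt, tendsto_iff_norm_sub_tendsto_zero]
  refine squeeze_zero' (.of_forall fun _ => norm_nonneg _) (eventually_of_mem hnhds hlip) ?_
  have hcont : Continuous fun s => M * (C * (‖w' a‖ + ‖w' b‖)) * ‖s - t‖ := by fun_prop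
  simpa using (hcont.tendsto t).mono_left nhdsWithin_le_nhds

theorem hasDerivWithinAt_of_mem_graph (hA : IsSpectralMeasureOf E A)
    (hI : Convex ℝ I) (hw : E.IsTruncSolutionOn w I) (hww' : ∀ t ∈ I, (w t, w' t) ∈ A.graph)
    (hw' : ContinuousOn w' I) {t : ℝ} (ht : t ∈ I) : HasDerivWithinAt w (w' t) I t := by
  obtain ⟨M, hM0, hM⟩ := E.exists_norm_truncProj_le
  refine hasDerivWithinAt_of_forall_clm hM0 (L := fun k => (E.truncProj k).restrictScalars ℝ)
    (fun k => (E.truncProj k).norm_restrictScalars.trans_le (hM k))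
    (fun x B => E.norm_le_of_forall_norm_truncProj_le) hI hw' (fun k s hs => ?_) ht
  exact hA.mem_graph_iff_forall_truncProj_eq.1 (hww' s hs) k ▸ hw k s hs

variable (hA : IsSpectralMeasureOf E A) (hI : I.OrdConnected) (hI_nontrivial : I.Nontrivial)
  (hy : IsWeakSolutionOn A y I)
include hA hI hI_nontrivial hy

theorem isTruncSolutionOn_iteratedDerivWithin (hsmooth : ContDiffOn ℝ ∞ y I) (n : ℕ) :
    E.IsTruncSolutionOn (iteratedDerivWithin n y I) I ∧
      ∀ t ∈ I, (iteratedDerivWithin n y I t, iteratedDerivWithin (n + 1) y I t) ∈ A.graph := by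
  have hI' := uniqueDiffOn_of_ordConnected hI hI_nontrivial
  have hgraph {n : ℕ} (h : E.IsTruncSolutionOn (iteratedDerivWithin n y I) I) :
      ∀ t ∈ I, (iteratedDerivWithin n y I t, iteratedDerivWithin (n + 1) y I t) ∈ A.graph :=
    fun t ht => hA.mem_graph_of_hasDerivWithinAt hI' h ht
      (hasDerivWithinAt_iteratedDerivWithin hsmooth hI' n ht)
  suffices h : E.IsTruncSolutionOn (iteratedDerivWithin n y I) I from ⟨h, hgraph h⟩
  induction n with
  | zero =>
    rw [iteratedDerivWithin_zero]
    exact hA.isTruncSolutionOn_of_isWeakSolutionOn hI.convex hy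
  | succ n ih => exact hA.isTruncSolutionOn_of_mem_graph ih (hgraph ih)

theorem mem_graph_opPow_iteratedDerivWithin (hsmooth : ContDiffOn ℝ ∞ y I) (n : ℕ) {t : ℝ}
    (ht : t ∈ I) : (y t, iteratedDerivWithin n y I t) ∈ (opPow A n).graph := by
  simpa only [iteratedDerivWithin_zero] using
    mem_graph_opPow_of_forall_mem_graph (v := fun n => iteratedDerivWithin n y I t)
      (fun n => (isTruncSolutionOn_iteratedDerivWithin hA hI hI_nontrivial hy hsmooth n).2 t ht) n

theorem exists_norm_iteratedDerivWithin_le_endpoints (hsmooth : ContDiffOn ℝ ∞ y I) :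
    ∃ C > 0, ∀ n, ∀ a ∈ I, ∀ b ∈ I, ∀ t ∈ Icc a b, ‖iteratedDerivWithin n y I t‖ ≤
      C * (‖iteratedDerivWithin n y I a‖ + ‖iteratedDerivWithin n y I b‖) := by
  obtain ⟨C, hC, hbound⟩ := SpectralMeasure.IsTruncSolutionOn.exists_norm_le_endpoints E
  exact ⟨C, hC, fun n a ha b hb => hbound
    ((isTruncSolutionOn_iteratedDerivWithin hA hI hI_nontrivial hy hsmooth n).1.mono
      (hI.out ha hb))⟩

theorem contDiffOn_of_mem_domain_opPow (hdom : ∀ t ∈ I, ∀ n, y t ∈ (opPow A n).domain) :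
    ContDiffOn ℝ ∞ y I := by
  choose! v hv0 hv using fun t ht => exists_orbit_of_forall_mem_domain_opPow (hdom t ht)
  have hgraph (n : ℕ) : ∀ t ∈ I, (v t n, v t (n + 1)) ∈ A.graph := fun t ht => hv t ht n
  have htrunc (n : ℕ) : E.IsTruncSolutionOn (fun t => v t n) I := by
    induction n with
    | zero => exact (hA.isTruncSolutionOn_of_isWeakSolutionOn hI.convex hy).congr hv0
    | succ n ih => exact hA.isTruncSolutionOn_of_mem_graph ih (hgraph n)
  have hderiv (n : ℕ) : ∀ t ∈ I, HasDerivWithinAt (fun s => v s n) (v t (n + 1)) I t := fun t ht =>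
    hA.hasDerivWithinAt_of_mem_graph hI.convex (htrunc n) (hgraph n)
      (hA.continuousOn_of_mem_graph hI (htrunc (n + 1)) (hgraph (n + 1))) ht
  exact (contDiffOn_of_forall_hasDerivWithinAt (v := fun n t => v t n)
    (uniqueDiffOn_of_ordConnected hI hI_nontrivial) hderiv).congr fun t ht => (hv0 t ht).symm

end IsSpectralMeasureOf

section GevreyBounds

/-- The common bound of the Gevrey classes, for a sequence of functions `f n`: with the `n`th
derivatives of a function it describes the classes on intervals, and on a singleton the classes of
vectors. -/
def HasGevreyBoundOn {V : Type*} [SeminormedAddCommGroup V] (β α : ℝ) (f : ℕ → ℝ → V)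
    (s : Set ℝ) : Prop :=
  ∃ c > (0 : ℝ), ∀ n : ℕ, ∀ t ∈ s, ‖f n t‖ ≤ c * α ^ n * (n.factorial : ℝ) ^ β

namespace HasGevreyBoundOn

variable {V : Type*} [SeminormedAddCommGroup V] {β α α' : ℝ} {f : ℕ → ℝ → V} {s : Set ℝ}
  {a b C : ℝ}

theorem mono_scale (h : HasGevreyBoundOn β α f s) (hα : 0 ≤ α) (hαα' : α ≤ α') :
    HasGevreyBoundOn β α' f s := by
  obtain ⟨c, hc, hbound⟩ := h
  exact ⟨c, hc, fun n t ht => (hbound n t ht).trans (by gcongr)⟩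

theorem Icc_of_endpoints (hC : 0 < C) (hf : ∀ n, ∀ t ∈ Icc a b, ‖f n t‖ ≤ C * (‖f n a‖ + ‖f n b‖))
    (ha : HasGevreyBoundOn β α f {a}) (hb : HasGevreyBoundOn β α f {b}) :
    HasGevreyBoundOn β α f (Icc a b) := by
  obtain ⟨c, hc, hfa⟩ := ha
  obtain ⟨d, hd, hfb⟩ := hb
  refine ⟨C * (c + d), by positivity, fun n t ht => ?_⟩
  calc ‖f n t‖ ≤ C * (‖f n a‖ + ‖f n b‖) := hf n t ht
    _ ≤ C * (c * α ^ n * (n.factorial : ℝ) ^ β + d * α ^ n * (n.factorial : ℝ) ^ β) := by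
        gcongr
        exacts [hfa n a rfl, hfb n b rfl]
    _ = C * (c + d) * α ^ n * (n.factorial : ℝ) ^ β := by ring

theorem of_isEmpty (hs : s = ∅) : HasGevreyBoundOn β α f s :=
  ⟨1, one_pos, by simp [hs]⟩

end HasGevreyBoundOn

variable {β : ℝ} {I : Set ℝ} {g : ℝ → X} {C : ℝ}

theorem mem_gevreyRoumieuOn_iff_forall_singleton (hg : ContDiffOn ℝ ∞ g I) (hC : 0 < C)
    (hbound : ∀ n, ∀ a ∈ I, ∀ b ∈ I, ∀ t ∈ Icc a b, ‖iteratedDerivWithin n g I t‖ ≤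
      C * (‖iteratedDerivWithin n g I a‖ + ‖iteratedDerivWithin n g I b‖)) :
    g ∈ gevreyRoumieuOn β I ↔ ∀ t ∈ I, ∃ α > 0,
      HasGevreyBoundOn β α (fun n => iteratedDerivWithin n g I) {t} := by
  refine ⟨fun h t ht => ?_, fun h => ⟨hg, fun a b hab => ?_⟩⟩
  · simpa only [HasGevreyBoundOn, Icc_self] using h.2 t t (by simpa using ht)
  rcases lt_or_ge b a with hba | hle
  · exact ⟨1, one_pos, HasGevreyBoundOn.of_isEmpty (Icc_eq_empty hba.not_ge)⟩
  have ha : a ∈ I := hab (left_mem_Icc.2 hle)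
  have hb : b ∈ I := hab (right_mem_Icc.2 hle)
  obtain ⟨αa, hαa, hga⟩ := h a ha
  obtain ⟨αb, hαb, hgb⟩ := h b hb
  exact ⟨max αa αb, lt_max_of_lt_left hαa, HasGevreyBoundOn.Icc_of_endpoints hC
    (fun n => hbound n a ha b hb) (hga.mono_scale hαa.le (le_max_left _ _))
    (hgb.mono_scale hαb.le (le_max_right _ _))⟩

theorem mem_gevreyBeurlingOn_iff_forall_singleton (hg : ContDiffOn ℝ ∞ g I) (hC : 0 < C)
    (hbound : ∀ n, ∀ a ∈ I, ∀ b ∈ I, ∀ t ∈ Icc a b, ‖iteratedDerivWithin n g I t‖ ≤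
      C * (‖iteratedDerivWithin n g I a‖ + ‖iteratedDerivWithin n g I b‖)) :
    g ∈ gevreyBeurlingOn β I ↔ ∀ t ∈ I, ∀ α > 0,
      HasGevreyBoundOn β α (fun n => iteratedDerivWithin n g I) {t} := by
  refine ⟨fun h t ht => ?_, fun h => ⟨hg, fun a b hab α hα => ?_⟩⟩
  · simpa only [HasGevreyBoundOn, Icc_self] using h.2 t t (by simpa using ht)
  rcases lt_or_ge b a with hba | hle
  · exact HasGevreyBoundOn.of_isEmpty (Icc_eq_empty hba.not_ge)
  have ha : a ∈ I := hab (left_mem_Icc.2 hle)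
  have hb : b ∈ I := hab (right_mem_Icc.2 hle)
  exact HasGevreyBoundOn.Icc_of_endpoints hC (fun n => hbound n a ha b hb) (h a ha α hα)
    (h b hb α hα)

variable {A : X →ₗ.[ℂ] X} {f : ℕ → ℝ → X} {t : ℝ}

theorem mem_gevreyRoumieuVec_iff {x : X} (h : ∀ n, (x, f n t) ∈ (opPow A n).graph) :
    x ∈ gevreyRoumieuVec β A ↔ ∃ α > 0, HasGevreyBoundOn β α f {t} := by
  choose hx hfx using fun n => exists_eq_apply_of_mem_graph (h n)
  simp only [HasGevreyBoundOn, mem_singleton_iff, forall_eq, hfx]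
  exact exists_prop_of_true hx

theorem mem_gevreyBeurlingVec_iff {x : X} (h : ∀ n, (x, f n t) ∈ (opPow A n).graph) :
    x ∈ gevreyBeurlingVec β A ↔ ∀ α > 0, HasGevreyBoundOn β α f {t} := by
  choose hx hfx using fun n => exists_eq_apply_of_mem_graph (h n)
  simp only [HasGevreyBoundOn, mem_singleton_iff, forall_eq, hfx]
  exact exists_prop_of_true hx

end GevreyBounds

end Gevrey

theorem proposition3p1_general {X : Type*} [NormedAddCommGroup X] [NormedSpace ℂ X]
    [CompleteSpace X] (A : X →ₗ.[ℂ] X) (E : Gevrey.SpectralMeasure X)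
    (hA : Gevrey.IsSpectralMeasureOf E A) (β : ℝ)
    (I : Set ℝ) (hI : I.OrdConnected) (hI_nontrivial : I.Nontrivial)
    (y : ℝ → X) (hy : Gevrey.IsWeakSolutionOn A y I) :
    ((y ∈ Gevrey.gevreyRoumieuOn β I ↔ ∀ t ∈ I, y t ∈ Gevrey.gevreyRoumieuVec β A) ∧
      (y ∈ Gevrey.gevreyRoumieuOn β I → ∀ n : ℕ, ∀ t ∈ I,
        ∃ h : y t ∈ (Gevrey.opPow A n).domain,
          iteratedDerivWithin n y I t = Gevrey.opPow A n ⟨y t, h⟩)) ∧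
    ((y ∈ Gevrey.gevreyBeurlingOn β I ↔ ∀ t ∈ I, y t ∈ Gevrey.gevreyBeurlingVec β A) ∧
      (y ∈ Gevrey.gevreyBeurlingOn β I → ∀ n : ℕ, ∀ t ∈ I,
        ∃ h : y t ∈ (Gevrey.opPow A n).domain,
          iteratedDerivWithin n y I t = Gevrey.opPow A n ⟨y t, h⟩)) := by
  have hgraph (hs : ContDiffOn ℝ ∞ y I) {t : ℝ} (ht : t ∈ I) (n : ℕ) :=
    hA.mem_graph_opPow_iteratedDerivWithin hI hI_nontrivial hy hs n ht
  have hsmooth := hA.contDiffOn_of_mem_domain_opPow hI hI_nontrivial hy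
  have hRoumieu (hs : ContDiffOn ℝ ∞ y I) :
      y ∈ Gevrey.gevreyRoumieuOn β I ↔ ∀ t ∈ I, y t ∈ Gevrey.gevreyRoumieuVec β A := by
    obtain ⟨C, hC, hbound⟩ :=
      hA.exists_norm_iteratedDerivWithin_le_endpoints hI hI_nontrivial hy hs
    exact (Gevrey.mem_gevreyRoumieuOn_iff_forall_singleton hs hC hbound).trans <|
      forall₂_congr fun t ht => (Gevrey.mem_gevreyRoumieuVec_iff (hgraph hs ht)).symm
  have hBeurling (hs : ContDiffOn ℝ ∞ y I) :
      y ∈ Gevrey.gevreyBeurlingOn β I ↔ ∀ t ∈ I, y t ∈ Gevrey.gevreyBeurlingVec β A := by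
    obtain ⟨C, hC, hbound⟩ :=
      hA.exists_norm_iteratedDerivWithin_le_endpoints hI hI_nontrivial hy hs
    exact (Gevrey.mem_gevreyBeurlingOn_iff_forall_singleton hs hC hbound).trans <|
      forall₂_congr fun t ht => (Gevrey.mem_gevreyBeurlingVec_iff (hgraph hs ht)).symm
  exact ⟨⟨⟨fun h => (hRoumieu h.1).1 h, fun h => (hRoumieu (hsmooth fun t ht => (h t ht).1)).2 h⟩,
      fun h n t ht => Gevrey.exists_eq_apply_of_mem_graph (hgraph h.1 ht n)⟩,
    ⟨⟨fun h => (hBeurling h.1).1 h, fun h => (hBeurling (hsmooth fun t ht => (h t ht).1)).2 h⟩,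
      fun h n t ht => Gevrey.exists_eq_apply_of_mem_graph (hgraph h.1 ht n)⟩⟩

theorem proposition3p1 {X : Type*} [NormedAddCommGroup X] [NormedSpace ℂ X] [CompleteSpace X]
    (A : X →ₗ.[ℂ] X) (E : Gevrey.SpectralMeasure X) (hA : Gevrey.IsSpectralMeasureOf E A)
    (β : ℝ) (hβ : 0 ≤ β)
    (I : Set ℝ) (hI : I.OrdConnected) (hI_nontrivial : I.Nontrivial) (hI_sub : I ⊆ Set.Ici 0)
    (y : ℝ → X) (hy : Gevrey.IsWeakSolution A y) :
    ((y ∈ Gevrey.gevreyRoumieuOn β I ↔ ∀ t ∈ I, y t ∈ Gevrey.gevreyRoumieuVec β A) ∧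
      (y ∈ Gevrey.gevreyRoumieuOn β I → ∀ n : ℕ, ∀ t ∈ I,
        ∃ h : y t ∈ (Gevrey.opPow A n).domain,
          iteratedDerivWithin n y I t = Gevrey.opPow A n ⟨y t, h⟩)) ∧
    ((y ∈ Gevrey.gevreyBeurlingOn β I ↔ ∀ t ∈ I, y t ∈ Gevrey.gevreyBeurlingVec β A) ∧
      (y ∈ Gevrey.gevreyBeurlingOn β I → ∀ n : ℕ, ∀ t ∈ I,
        ∃ h : y t ∈ (Gevrey.opPow A n).domain,
          iteratedDerivWithin n y I t = Gevrey.opPow A n ⟨y t, h⟩)) := by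
  exact proposition3p1_general A E hA β I hI hI_nontrivial y (hy.isWeakSolutionOn hI_sub)
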